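/- For a set $X$ (possibly empty), consider partial functions $f\colon X\to X$, written as sets of pairs, and the following operations on them: composition $f;g=\{(x,y)\mid \exists z\,((x,z)\in f,\ (z,y)\in g)\}$; domain $\mathsf d(f)=\{(x,x)\mid \exists y\,(x,y)\in f\}$; antidomain $\mathsf a(f)=\{(x,x)\mid x\in X,\ \forall y\,(x,y)\notin f\}$; range $\mathsf r(f)=\{(y,y)\mid \exists x\,(x,y)\in f\}$; fixset $\mathsf{fix}(f)=\{(x,x)\mid (x,x)\in f\}$; preferential union $f\sqcup g$, where $(f\sqcup g)(x)$ is $f(x)$ if $f(x)$ is defined and $g(x)$ otherwise; maximum iterate $f^{\uparrow}=\bigsqcup_{n<\omega}\bigl(f^n;\mathsf a(f)\bigr)$, where $f^0$ is the identity on $X$; and the constants $0=\varnothing$ and $1'=\{(x,x)\mid x\in X\}$. For a set $\tau$ of such operation symbols, a $\tau$-algebra is a set $S$ with an operation of the right arity for each symbol in $\tau$. A $\tau$-algebra of functions with base $X$ is a set of partial functions on $X$ closed under the operations in $\tau$, with these operations. A $\tau$-algebra is representable over the base $X$ if it is isomorphic to a $\tau$-algebra of functions with base $X$, and representable if it is representable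 over some base. Theorem. Let $\tau$ be a signature with $$\{;,\mathsf d,\mathsf r\}\subseteq\tau\subseteq\{;,\mathsf d,\mathsf a,\mathsf r,\mathsf{fix},0,1'\}$$ or with $$\{;,\mathsf a,\mathsf r,\sqcup\}\subseteq\tau\subseteq\{;,\mathsf d,\mathsf a,\mathsf r,\mathsf{fix},\sqcup,{}^{\uparrow},0,1'\}.$$ Then every finite representable $\tau$-algebra $\mathscr S$ with underlying set $S$ is representable over a (finite) base of size at most $|S|^{|S|+1}$. -/

import Mathlib

universe u v

/-- Symbols for the operations on unary partial functions: composition, intersection, domain,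
antidomain, range, fixset, preferential union, maximum iterate, the empty function and the
identity function. -/
inductive OpSym : Type
  | comp | inter | dom | antidom | ran | fix | punion | iter | zero | one

namespace OpSym

/-- The number of arguments of an operation. -/
def arity : OpSym → ℕ
  | comp => 2
  | inter => 2
  | dom => 1
  | antidom => 1
  | ran => 1
  | fix => 1
  | punion => 2
  | iter => 1
  | zero => 0
  | one => 0

end OpSym

/-- The purely algebraic first-order language whose function symbols are those in `τ`; a
`τ`-algebra is a structure for this language. -/
def sigLang (τ : Set OpSym) : FirstOrder.Language.{0, 0} where
  Functions n := {o : OpSym // o ∈ τ ∧ o.arity = n}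
  Relations _ := Empty

namespace PartialMap

variable {X : Type u}

/-- `f ; g`, first `f`, then `g`. -/
def comp (f g : X →. X) : X →. X := fun x => (f x).bind fun z => g z

/-- The points where `f` and `g` are both defined and agree. -/
def inter (f g : X →. X) : X →. X :=
  fun x => ⟨∃ h : (f x).Dom, (f x).get h ∈ g x, fun h => (f x).get h.1⟩

/-- The identity restricted to the domain of `f`. -/
def dom (f : X →. X) : X →. X := fun x => ⟨∃ y, y ∈ f x, fun _ => x⟩

/-- The identity restricted to the complement, in the base `X`, of the domain of `f`. -/
def antidom (f : X →. X) : X →. X := fun x => ⟨∀ y, y ∉ f x, fun _ => x⟩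

/-- The identity restricted to the range of `f`. -/
def ran (f : X →. X) : X →. X := fun y => ⟨∃ x, y ∈ f x, fun _ => y⟩

/-- The identity restricted to the fixed points of `f`. -/
def fix (f : X →. X) : X →. X := fun x => ⟨x ∈ f x, fun _ => x⟩

/-- The empty function. -/
def zero : X →. X := fun _ => Part.none

/-- The identity function on the base. -/
def one : X →. X := PFun.id X

open Classical in
/-- Preferential union: `f x` if this is defined and `g x` otherwise. -/
noncomputable def punion (f g : X →. X) : X →. X :=
  fun x => if (f x).Dom then f x else g x

/-- The `n`-fold composition of `f` with itself; the identity for `n = 0`. -/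
def pow (f : X →. X) : ℕ → (X →. X)
  | 0 => one
  | n + 1 => comp (pow f n) f

open Classical in
/-- The preferential union of the sequence `F 0`, `F 1`, …: at `x` it takes the value of the first
`F n` that is defined at `x`, if there is one. -/
noncomputable def iPunion (F : ℕ → (X →. X)) : X →. X :=
  fun x => ⟨∃ n, (F n x).Dom, fun h => (F (Nat.find h) x).get (Nat.find_spec h)⟩

/-- Maximum iterate: the preferential union of the functions `fⁿ ; a(f)` over all `n`. -/
noncomputable def iter (f : X →. X) : X →. X := iPunion fun n => comp (pow f n) (antidom f)

/-- The interpretation of the operation symbols on partial functions. -/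
noncomputable def interp : (o : OpSym) → (Fin o.arity → (X →. X)) → (X →. X)
  | .comp, v => comp (v (0 : Fin 2)) (v (1 : Fin 2))
  | .inter, v => inter (v (0 : Fin 2)) (v (1 : Fin 2))
  | .dom, v => dom (v (0 : Fin 1))
  | .antidom, v => antidom (v (0 : Fin 1))
  | .ran, v => ran (v (0 : Fin 1))
  | .fix, v => fix (v (0 : Fin 1))
  | .punion, v => punion (v (0 : Fin 2)) (v (1 : Fin 2))
  | .iter, v => iter (v (0 : Fin 1))
  | .zero, _ => zero
  | .one, _ => one

end PartialMap

/-- The `τ`-algebra of all partial functions on `X`. -/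
noncomputable instance partialMapStructure (τ : Set OpSym) (X : Type u) :
    (sigLang τ).Structure (X →. X) where
  funMap o v := PartialMap.interp o.1 fun i => v (Fin.cast o.2.2 i)
  RelMap r _ := r.elim

/-- A `τ`-algebra of functions with base `X` is a set of partial functions on `X` closed under the
operations in `τ`. -/
abbrev FunAlgebra (τ : Set OpSym) (X : Type u) := (sigLang τ).Substructure (X →. X)

/-- `S` is representable over the base `X`: it is isomorphic, as a `τ`-algebra, to a `τ`-algebra
of functions with base `X`. -/
def RepresentableOver (τ : Set OpSym) (S : Type u) [(sigLang τ).Structure S] (X : Type v) : Prop :=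
  ∃ A : FunAlgebra τ X, Nonempty ((sigLang τ).Equiv S A)

/-- `S` is representable: it is representable over some base. -/
def Representable (τ : Set OpSym) (S : Type u) [(sigLang τ).Structure S] : Prop :=
  ∃ X : Type v, RepresentableOver τ S X

/-!
Let `θ` be a representation of the finite algebra `S` over an arbitrary base `X`. The idea is to
remember of a point `x` only its *orbit* `{x s | s ∈ S}` under the action of `S`, together with
colours for the points of the orbit drawn from a fixed set of `|S|` colours. If `c` colours the
points, injectively on the orbit of `x`, then the *code* of `x` is the partial function
`s ↦ c (x s)` from `S` to colours. Codes are the points of the new base, and `s` sends a code `φ`,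
if `φ s` is defined, to `u ↦ φ (s u)`, which is the code of `x s` under the same colouring. Points in
no domain are discarded; the others lie in their own orbits because of the elements `d(s)`.

* With `c` fixed, the orbit of `x` and its codes are isomorphic, as structures for the action.
  Composition, intersection, domain, antidomain, fixset, preferential union, maximum iterate and
  the constants are evaluated at `x` inside the orbit of `x`, so they are preserved
  (`Simulates.interp`, `simulates_act`, `simulates_act_flip`). Elements of `S` that differ at `x`
  also differ at a code of `x`, so the new representation is faithful.
* Range is the one operation that looks outside the orbit. If `y = z f`, then the orbit of `y` is
  contained in that of `z`, which has at most `|S|` points, so an injective colouring of the former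
  extends to one of the latter (`exists_injOn_extension`), and the code of `z` is sent by `f` to
  the given code of `y`.
* With `n = |S|`, a code is a function from `S` to colours or `none` that is not constantly
  `none`, so there are at most `(n + 1) ^ n - 1 ≤ n ^ (n + 1)` of them.
-/

namespace PartialMap

/-! ### Membership in the values of the operations -/

section Membership

variable {X : Type*} {f g : X →. X} {x y : X}

theorem mem_comp : y ∈ comp f g x ↔ ∃ z ∈ f x, y ∈ g z := by
  simp [comp]

theorem mem_inter : y ∈ inter f g x ↔ y ∈ f x ∧ y ∈ g x := by
  constructor
  · rintro ⟨⟨h, h'⟩, rfl⟩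
    exact ⟨Part.get_mem h, h'⟩
  · rintro ⟨⟨h, rfl⟩, h'⟩
    exact ⟨⟨h, h'⟩, rfl⟩

theorem mem_dom : y ∈ dom f x ↔ y = x ∧ ∃ z, z ∈ f x := by
  constructor
  · rintro ⟨h, rfl⟩
    exact ⟨rfl, h⟩
  · rintro ⟨rfl, h⟩
    exact ⟨h, rfl⟩

theorem mem_antidom : y ∈ antidom f x ↔ y = x ∧ ∀ z, z ∉ f x := by
  constructor
  · rintro ⟨h, rfl⟩
    exact ⟨rfl, h⟩
  · rintro ⟨rfl, h⟩
    exact ⟨h, rfl⟩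

theorem mem_ran : y ∈ ran f x ↔ y = x ∧ ∃ z, x ∈ f z := by
  constructor
  · rintro ⟨h, rfl⟩
    exact ⟨rfl, h⟩
  · rintro ⟨rfl, h⟩
    exact ⟨h, rfl⟩

theorem mem_fix : y ∈ fix f x ↔ y = x ∧ x ∈ f x := by
  constructor
  · rintro ⟨h, rfl⟩
    exact ⟨rfl, h⟩
  · rintro ⟨rfl, h⟩
    exact ⟨h, rfl⟩

theorem mem_one : y ∈ (one : X →. X) x ↔ y = x := by
  simp [one, PFun.id]

theorem mem_punion : y ∈ punion f g x ↔ y ∈ f x ∨ (∀ z, z ∉ f x) ∧ y ∈ g x := by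
  unfold punion
  split_ifs with h
  · exact ⟨Or.inl, fun h' => h'.elim id fun h' => (h'.1 _ (Part.get_mem h)).elim⟩
  · have h' : ∀ z, z ∉ f x := fun z hz => h (Part.dom_iff_mem.2 ⟨z, hz⟩)
    simp [h']

theorem mem_iPunion {F : ℕ → (X →. X)} :
    y ∈ iPunion F x ↔ ∃ n, y ∈ F n x ∧ ∀ m < n, ∀ z, z ∉ F m x := by
  classical
  constructor
  · rintro ⟨h, rfl⟩
    refine ⟨Nat.find h, Part.get_mem _, fun m hm z hz => ?_⟩
    exact Nat.find_min h hm (Part.dom_iff_mem.2 ⟨z, hz⟩)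
  · rintro ⟨n, hy, hn⟩
    have h : ∃ n, (F n x).Dom := ⟨n, Part.dom_iff_mem.2 ⟨y, hy⟩⟩
    have hfind : Nat.find h = n := (Nat.find_eq_iff h).2
      ⟨Part.dom_iff_mem.2 ⟨y, hy⟩, fun m hm hd => hn m hm _ (Part.get_mem hd)⟩
    subst hfind
    refine ⟨h, ?_⟩
    exact Part.get_eq_of_mem hy (Part.dom_iff_mem.2 ⟨y, hy⟩)

end Membership

/-! ### Simulations between partial functions -/

section Simulation

variable {X Y : Type*}

/-- `F'` simulates `F` along `R`: every step of `F` from a point `x` is matched by a step of `F'`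
from any point related to `x`. -/
def Simulates (R : X → Y → Prop) (F : X →. X) (F' : Y →. Y) : Prop :=
  ∀ ⦃x y⦄, R x y → ∀ x' ∈ F x, ∃ y' ∈ F' y, R x' y'

namespace Simulates

variable {R : X → Y → Prop} {F G : X →. X} {F' G' : Y →. Y}

theorem not_mem (hF : Simulates (flip R) F' F) {x : X} {y : Y} (hR : R x y)
    (h : ∀ x', x' ∉ F x) : ∀ y', y' ∉ F' y := fun y' hy' =>
  let ⟨x', hx', _⟩ := hF hR y' hy'
  h x' hx'

theorem comp (hF : Simulates R F F') (hG : Simulates R G G') :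
    Simulates R (comp F G) (PartialMap.comp F' G') := by
  intro x y hR x' hx'
  obtain ⟨z, hz, hx'⟩ := mem_comp.1 hx'
  obtain ⟨w, hw, hzw⟩ := hF hR z hz
  obtain ⟨y', hy', hR'⟩ := hG hzw x' hx'
  exact ⟨y', mem_comp.2 ⟨w, hw, hy'⟩, hR'⟩

theorem antidom (hF : Simulates (flip R) F' F) :
    Simulates R (antidom F) (PartialMap.antidom F') := by
  intro x y hR x' hx'
  obtain ⟨rfl, h⟩ := mem_antidom.1 hx'
  exact ⟨y, mem_antidom.2 ⟨rfl, hF.not_mem hR h⟩, hR⟩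

theorem one : Simulates R one PartialMap.one := by
  intro x y hR x' hx'
  obtain rfl := mem_one.1 hx'
  exact ⟨y, mem_one.2 rfl, hR⟩

theorem pow (hF : Simulates R F F') (n : ℕ) : Simulates R (pow F n) (PartialMap.pow F' n) := by
  induction n with
  | zero => exact one
  | succ n ih => exact ih.comp hF

theorem iPunion {F : ℕ → (X →. X)} {F' : ℕ → (Y →. Y)} (h : ∀ n, Simulates R (F n) (F' n))
    (h' : ∀ n, Simulates (flip R) (F' n) (F n)) :
    Simulates R (iPunion F) (PartialMap.iPunion F') := by
  intro x y hR x' hx'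
  obtain ⟨n, hn, hlt⟩ := mem_iPunion.1 hx'
  obtain ⟨y', hy', hR'⟩ := h n hR x' hn
  exact ⟨y', mem_iPunion.2 ⟨n, hy', fun m hm => (h' m).not_mem hR (hlt m hm)⟩, hR'⟩

/-- Bisimulations along a one-to-one relation are preserved by all operations except range. This
is one half of that claim, for which `R` need only be single-valued; the other half is the same
statement for the flipped relation. -/
theorem interp (hr : Relator.RightUnique R) {o : OpSym}
    (ho : o ≠ .ran) {v : Fin o.arity → (X →. X)} {v' : Fin o.arity → (Y →. Y)}
    (h : ∀ i, Simulates R (v i) (v' i)) (h' : ∀ i, Simulates (flip R) (v' i) (v i)) :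
    Simulates R (interp o v) (PartialMap.interp o v') := by
  cases o with
  | comp => exact (h (0 : Fin 2)).comp (h (1 : Fin 2))
  | inter =>
    intro x y hR x' hx'
    obtain ⟨h0, h1⟩ := mem_inter.1 hx'
    obtain ⟨y0, hy0, hR0⟩ := h (0 : Fin 2) hR x' h0
    obtain ⟨y1, hy1, hR1⟩ := h (1 : Fin 2) hR x' h1
    obtain rfl := hr hR0 hR1
    exact ⟨y0, mem_inter.2 ⟨hy0, hy1⟩, hR0⟩
  | dom =>
    intro x y hR x' hx'
    obtain ⟨rfl, z, hz⟩ := mem_dom.1 hx'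
    obtain ⟨w, hw, -⟩ := h (0 : Fin 1) hR z hz
    exact ⟨y, mem_dom.2 ⟨rfl, w, hw⟩, hR⟩
  | antidom => exact antidom (h' (0 : Fin 1))
  | ran => exact (ho rfl).elim
  | fix =>
    intro x y hR x' hx'
    obtain ⟨rfl, hx⟩ := mem_fix.1 hx'
    obtain ⟨w, hw, hRw⟩ := h (0 : Fin 1) hR _ hx
    obtain rfl := hr hR hRw
    exact ⟨y, mem_fix.2 ⟨rfl, hw⟩, hR⟩
  | punion =>
    intro x y hR x' hx'
    rcases mem_punion.1 hx' with hx | ⟨hn, hx⟩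
    · obtain ⟨w, hw, hRw⟩ := h (0 : Fin 2) hR _ hx
      exact ⟨w, mem_punion.2 (.inl hw), hRw⟩
    · obtain ⟨w, hw, hRw⟩ := h (1 : Fin 2) hR _ hx
      exact ⟨w, mem_punion.2 (.inr ⟨(h' (0 : Fin 2)).not_mem hR hn, hw⟩), hRw⟩
  | iter =>
    exact iPunion (fun n => ((h (0 : Fin 1)).pow n).comp (antidom (h' (0 : Fin 1))))
      fun n => ((h' (0 : Fin 1)).pow n).comp (antidom (h (0 : Fin 1)))
  | zero => exact fun x y _ x' hx' => (Part.notMem_none x' hx').elim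
  | one => exact one

end Simulates

end Simulation

/-! ### Injective colourings -/

/-- A colouring that is injective on `A` can be changed outside `A` so as to be injective on a
larger finite set `B`, as long as there are at least as many colours as points of `B`. -/
theorem exists_injOn_extension {X C : Type*} [Finite C] {A B : Set X} (hAB : A ⊆ B)
    (hB : B.Finite) (hcard : B.ncard ≤ Nat.card C) {c : X → C} (hc : Set.InjOn c A) :
    ∃ c' : X → C, Set.InjOn c' B ∧ Set.EqOn c' c A := by
  classical
  have hBA : (B \ A).Finite := hB.sdiff
  have hle : (B \ A).ncard ≤ (c '' A)ᶜ.ncard := by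
    rw [Set.ncard_compl, hc.ncard_image, Set.ncard_sdiff hAB (hB.subset hAB)]
    omega
  have := hBA.to_subtype
  have := Fintype.ofFinite ↥(B \ A)
  have := Fintype.ofFinite ↥(c '' A)ᶜ
  obtain ⟨k⟩ : Nonempty (↥(B \ A) ↪ ↥(c '' A)ᶜ) := by
    apply Function.Embedding.nonempty_of_card_le
    rwa [← Nat.card_eq_fintype_card, ← Nat.card_eq_fintype_card, Nat.card_coe_set_eq,
      Nat.card_coe_set_eq]
  refine ⟨fun x => if h : x ∈ B \ A then k ⟨x, h⟩ else c x, ?_, fun x hx => by simp [hx]⟩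
  intro x hx y hy hxy
  by_cases hxA : x ∈ A <;> by_cases hyA : y ∈ A
  · exact hc hxA hyA (by simpa [hxA, hyA] using hxy)
  · have hxy : c x = k ⟨y, hy, hyA⟩ := by simpa [hxA, hyA, hy] using hxy
    exact ((k ⟨y, hy, hyA⟩).2 ⟨x, hxA, hxy⟩).elim
  · have hxy : (k ⟨x, hx, hxA⟩ : C) = c y := by simpa [hxA, hyA, hx] using hxy
    exact ((k ⟨x, hx, hxA⟩).2 ⟨y, hyA, hxy.symm⟩).elim
  · have hxy : (k ⟨x, hx, hxA⟩ : C) = k ⟨y, hy, hyA⟩ := by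
      simpa [hxA, hyA, hx, hy] using hxy
    exact congrArg Subtype.val (k.injective (Subtype.ext hxy))

/-! ### Codes of points and the action on them -/

section Code

variable {I X : Type*} {θ : I → (X →. X)}

/-- The points `θ s x` to which `x` is sent by the functions of the family `θ`. -/
def orbit (θ : I → (X →. X)) (x : X) : Set X := {y | ∃ s, y ∈ θ s x}

theorem finite_orbit [Finite I] (x : X) : (orbit θ x).Finite := by
  choose s hs using fun y : orbit θ x => y.2
  exact Finite.of_injective s fun y z h => Subtype.ext
    (Part.mem_unique (hs y) (h ▸ hs z))

theorem ncard_orbit_le [Finite I] (x : X) : (orbit θ x).ncard ≤ Nat.card I := by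
  choose s hs using fun y : orbit θ x => y.2
  rw [← Nat.card_coe_set_eq]
  exact Nat.card_le_card_of_injective s fun y z h => Subtype.ext
    (Part.mem_unique (hs y) (h ▸ hs z))

/-- The code of the point `x` under the colouring `c`: it records at which `s` the function `θ s`
is defined at `x`, and then the colour of the value. The elements of `I` serve as colours too. -/
def code (θ : I → (X →. X)) (c : X → I) (x : X) : I → Part I := fun s => (θ s x).map c

theorem code_congr {c c' : X → I} {x : X} (h : Set.EqOn c' c (orbit θ x)) :
    code θ c' x = code θ c x := by
  funext s
  refine Part.ext fun j => ?_
  simp only [code, Part.mem_map_iff]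
  exact exists_congr fun z => and_congr_right fun hz => by rw [h ⟨s, hz⟩]

/-- The new base: the codes of the points that lie in the domain of some `θ s`, under the
colourings that are injective on the orbit. -/
def Code (θ : I → (X →. X)) : Type _ :=
  {φ : I → Part I // ∃ x c, (orbit θ x).Nonempty ∧ Set.InjOn c (orbit θ x) ∧ φ = code θ c x}

variable {mul : I → I → I}

theorem orbit_subset (hmul : ∀ s t, θ (mul s t) = comp (θ s) (θ t)) {s : I} {x y : X}
    (h : y ∈ θ s x) : orbit θ y ⊆ orbit θ x := by
  rintro z ⟨t, ht⟩
  exact ⟨mul s t, by rw [hmul]; exact mem_comp.2 ⟨y, h, ht⟩⟩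

theorem code_mul (hmul : ∀ s t, θ (mul s t) = comp (θ s) (θ t)) {c : X → I} {s : I} {x y : X}
    (h : y ∈ θ s x) (t : I) : code θ c x (mul s t) = code θ c y t := by
  simp [code, hmul, comp, Part.eq_some_iff.2 h]

theorem self_mem_orbit (hdom : ∀ s, ∃ e, θ e = dom (θ s)) {x : X} (h : (orbit θ x).Nonempty) :
    x ∈ orbit θ x := by
  obtain ⟨z, s, hz⟩ := h
  obtain ⟨e, he⟩ := hdom s
  exact ⟨e, by rw [he]; exact mem_dom.2 ⟨rfl, z, hz⟩⟩

theorem orbit_nonempty_of_mem (hran : ∀ s, ∃ e, θ e = ran (θ s)) {s : I} {x y : X}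
    (h : y ∈ θ s x) : (orbit θ y).Nonempty := by
  obtain ⟨e, he⟩ := hran s
  exact ⟨y, e, by rw [he]; exact mem_ran.2 ⟨rfl, x, h⟩⟩

/-- Within one orbit, on which the colouring is injective, points are determined by their codes. -/
theorem eq_of_code_eq (hdom : ∀ s, ∃ e, θ e = dom (θ s)) {c : X → I} {O : Set X}
    (hc : Set.InjOn c O) {y z : X} (hy : y ∈ O) (hz : z ∈ O) (hne : (orbit θ y).Nonempty)
    (h : code θ c y = code θ c z) : y = z := by
  obtain ⟨w, s, hw⟩ := hne
  obtain ⟨e, he⟩ := hdom s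
  have hmem : c y ∈ code θ c y e :=
    Part.mem_map c (by rw [he]; exact mem_dom.2 ⟨rfl, w, hw⟩)
  rw [h] at hmem
  obtain ⟨z', hz', hcz⟩ := (Part.mem_map_iff c).1 hmem
  rw [he] at hz'
  obtain rfl := (mem_dom.1 hz').1
  exact hc hy hz hcz.symm

/-- The action of `s` on codes: it sends `φ`, if `φ s` is defined, to `t ↦ φ (s t)`. -/
def act (hmul : ∀ s t, θ (mul s t) = comp (θ s) (θ t)) (hran : ∀ s, ∃ e, θ e = ran (θ s))
    (s : I) : Code θ →. Code θ := fun φ =>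
  ⟨(φ.1 s).Dom, fun h => ⟨fun t => φ.1 (mul s t), by
    obtain ⟨x, c, -, hc, hφ⟩ := φ.2
    rw [hφ] at h
    obtain ⟨y, hy⟩ : ∃ y, y ∈ θ s x := Part.dom_iff_mem.1 h
    exact ⟨y, c, orbit_nonempty_of_mem hran hy, hc.mono (orbit_subset hmul hy),
      funext fun t => by rw [hφ, code_mul hmul hy]⟩⟩⟩

section Act

variable (hmul : ∀ s t, θ (mul s t) = comp (θ s) (θ t)) (hran : ∀ s, ∃ e, θ e = ran (θ s))

theorem mem_act_iff {s : I} {φ ψ : Code θ} {c : X → I} {x : X} (hφ : φ.1 = code θ c x) :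
    ψ ∈ act hmul hran s φ ↔ ∃ y ∈ θ s x, ψ.1 = code θ c y := by
  constructor
  · rintro ⟨h, rfl⟩
    change (φ.1 s).Dom at h
    rw [hφ] at h
    obtain ⟨y, hy⟩ : ∃ y, y ∈ θ s x := Part.dom_iff_mem.1 h
    refine ⟨y, hy, funext fun t => ?_⟩
    change φ.1 (mul s t) = _
    rw [hφ, code_mul hmul hy]
  · rintro ⟨y, hy, hψ⟩
    have hd : (φ.1 s).Dom := by
      rw [hφ]
      exact (Part.dom_iff_mem.2 ⟨y, hy⟩ : (θ s x).Dom)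
    refine ⟨hd, Subtype.ext (funext fun t => ?_)⟩
    change φ.1 (mul s t) = _
    rw [hφ, hψ, code_mul hmul hy]

/-- For a fixed colouring `c`, a point of `O` is related to its code. -/
def CodedBy (θ : I → (X →. X)) (c : X → I) (O : Set X) (x : X) (φ : Code θ) : Prop :=
  x ∈ O ∧ φ.1 = code θ c x

theorem codedBy_rightUnique {c : X → I} {O : Set X} :
    Relator.RightUnique (CodedBy θ c O) := fun _ _ _ h h' =>
  Subtype.ext (h.2.trans h'.2.symm)

theorem codedBy_leftUnique (hdom : ∀ s, ∃ e, θ e = dom (θ s)) {c : X → I} {O : Set X}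
    (hc : Set.InjOn c O) (hne : ∀ x ∈ O, (orbit θ x).Nonempty) :
    Relator.LeftUnique (CodedBy θ c O) := fun x _ _ h h' =>
  eq_of_code_eq hdom hc h.1 h'.1 (hne x h.1) (h.2.symm.trans h'.2)

theorem simulates_act {c : X → I} {x : X} (hc : Set.InjOn c (orbit θ x)) (s : I) :
    Simulates (CodedBy θ c (orbit θ x)) (θ s) (act hmul hran s) := by
  rintro y φ ⟨⟨t, hy⟩, hφ⟩ z hz
  have hsub := (orbit_subset hmul hz).trans (orbit_subset hmul hy)
  exact ⟨⟨code θ c z, z, c, orbit_nonempty_of_mem hran hz, hc.mono hsub, rfl⟩,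
    (mem_act_iff hmul hran hφ).2 ⟨z, hz, rfl⟩, orbit_subset hmul hy ⟨s, hz⟩, rfl⟩

theorem simulates_act_flip {c : X → I} {x : X} (s : I) :
    Simulates (flip (CodedBy θ c (orbit θ x))) (act hmul hran s) (θ s) := by
  rintro φ y ⟨⟨t, hy⟩, hφ⟩ ψ hψ
  obtain ⟨z, hz, h⟩ := (mem_act_iff hmul hran hφ).1 hψ
  exact ⟨z, hz, orbit_subset hmul hy ⟨s, hz⟩, h⟩

/-- Every code of a point in the range of `θ s` is in the range of the action of `s`: the colouring
extends injectively to the orbit of a preimage. -/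
theorem exists_mem_act [Finite I] {c : X → I} {s : I} {x z : X} (hx : x ∈ θ s z)
    (hc : Set.InjOn c (orbit θ x)) {φ : Code θ} (hφ : φ.1 = code θ c x) :
    ∃ ψ, φ ∈ act hmul hran s ψ := by
  obtain ⟨c', hc', heq⟩ := exists_injOn_extension (orbit_subset hmul hx) (finite_orbit z)
    (ncard_orbit_le z) hc
  refine ⟨⟨code θ c' z, z, c', ⟨x, s, hx⟩, hc', rfl⟩, (mem_act_iff hmul hran rfl).2 ⟨x, hx, ?_⟩⟩
  rw [hφ, code_congr heq]

/-- Every instance of an operation that holds in the family `θ` also holds in the action on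
codes. -/
theorem act_eq_interp [Finite I] (hdom : ∀ s, ∃ e, θ e = dom (θ s)) {o : OpSym}
    {v : Fin o.arity → I} {w : I} (h : θ w = interp o fun i => θ (v i)) :
    act hmul hran w = interp o fun i => act hmul hran (v i) := by
  funext φ
  obtain ⟨x, c, hne, hc, hφ⟩ := id φ.2
  have hx := self_mem_orbit hdom hne
  have hR : CodedBy θ c (orbit θ x) x φ := ⟨hx, hφ⟩
  by_cases ho : o = .ran
  · subst ho
    change θ w = ran (θ (v (0 : Fin 1))) at h
    change _ = ran (act hmul hran (v (0 : Fin 1))) φ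
    refine Part.ext fun ψ => ?_
    rw [mem_act_iff hmul hran hφ, mem_ran, h]
    constructor
    · rintro ⟨y, hy, hψ⟩
      obtain ⟨rfl, z, hz⟩ := mem_ran.1 hy
      exact ⟨Subtype.ext (hψ.trans hφ.symm), exists_mem_act hmul hran hz hc hφ⟩
    · rintro ⟨rfl, χ, hχ⟩
      -- `ψ` is also a code of a point `z` in the range, and codes determine the domain of `θ w`.
      obtain ⟨y, d, -, -, hy⟩ := id χ.2
      obtain ⟨z, hz, hψz⟩ := (mem_act_iff hmul hran hy).1 hχ
      have hmem : d z ∈ ψ.1 w := by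
        rw [hψz]
        exact Part.mem_map d (by rw [h]; exact mem_ran.2 ⟨rfl, y, hz⟩)
      rw [hφ] at hmem
      obtain ⟨x', hx', -⟩ := (Part.mem_map_iff c).1 hmem
      rw [h] at hx'
      obtain rfl := (mem_ran.1 hx').1
      exact ⟨x', hx', hφ⟩
  · have hl := codedBy_leftUnique hdom hc fun y ⟨s, hy⟩ => orbit_nonempty_of_mem hran hy
    have hr := codedBy_rightUnique (θ := θ) (c := c) (O := orbit θ x)
    have hs := simulates_act hmul hran hc
    have hs' := simulates_act_flip hmul hran (c := c) (x := x)
    refine Part.ext fun ψ => ⟨fun hψ => ?_, fun hψ => ?_⟩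
    · obtain ⟨y, hy, hyψ⟩ := hs' w hR ψ hψ
      rw [h] at hy
      obtain ⟨ψ', hψ', hyψ'⟩ :=
        Simulates.interp hr ho (fun i => hs (v i)) (fun i => hs' (v i)) hR y hy
      exact hr hyψ hyψ' ▸ hψ'
    · obtain ⟨y, hy, hyψ⟩ := Simulates.interp (R := flip (CodedBy θ c (orbit θ x)))
        (fun _ _ _ h h' => hl h h') ho
        (fun i => hs' (v i)) (fun i => hs (v i)) hR ψ hψ
      rw [← h] at hy
      obtain ⟨ψ', hψ', hyψ'⟩ := hs w hR y hy
      exact hr hyψ hyψ' ▸ hψ'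

theorem act_injective [Finite I] (hdom : ∀ s, ∃ e, θ e = dom (θ s))
    (hθ : Function.Injective θ) : Function.Injective (act hmul hran) := by
  have key : ∀ s t, act hmul hran s = act hmul hran t → ∀ x, ∀ y ∈ θ s x, y ∈ θ t x := by
    intro s t hst x y hy
    have hne : (orbit θ x).Nonempty := ⟨y, s, hy⟩
    obtain ⟨c, hc, -⟩ := exists_injOn_extension (Set.empty_subset _) (finite_orbit x)
      (ncard_orbit_le x) (Set.injOn_empty fun _ => s)
    have hR : CodedBy θ c (orbit θ x) x ⟨code θ c x, x, c, hne, hc, rfl⟩ :=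
      ⟨self_mem_orbit hdom hne, rfl⟩
    obtain ⟨φ, hφ, hyφ⟩ := simulates_act hmul hran hc s hR y hy
    rw [hst] at hφ
    obtain ⟨z, hz, hzφ⟩ := simulates_act_flip hmul hran t hR φ hφ
    have hyz := codedBy_leftUnique hdom hc
      (fun y ⟨s, hy⟩ => orbit_nonempty_of_mem hran hy) hyφ hzφ
    exact hyz ▸ hz
  intro s t hst
  exact hθ (funext fun x => Part.ext fun y => ⟨key s t hst x y, key t s hst.symm x y⟩)

end Act

end Code

/-! ### Counting codes -/

theorem succ_pow_le_pow_succ {n : ℕ} (hn : 3 ≤ n) : (n + 1) ^ n ≤ n ^ (n + 1) := by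
  induction n, hn using Nat.le_induction with
  | base => norm_num
  | succ n hn ih =>
    refine Nat.le_of_mul_le_mul_right ?_ (show 0 < n ^ (n + 1) by positivity)
    calc (n + 1 + 1) ^ (n + 1) * n ^ (n + 1) = ((n + 2) * n) ^ (n + 1) := (mul_pow _ _ _).symm
      _ ≤ ((n + 1) * (n + 1)) ^ (n + 1) := Nat.pow_le_pow_left (by nlinarith) _
      _ = (n + 1) ^ (n + 1 + 1) * (n + 1) ^ n := by
        rw [← sq, ← pow_mul, ← pow_add]
        congr 1
        ring
      _ ≤ (n + 1) ^ (n + 1 + 1) * n ^ (n + 1) := Nat.mul_le_mul_left _ ih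

theorem succ_pow_sub_one_le_pow_succ (n : ℕ) : (n + 1) ^ n - 1 ≤ n ^ (n + 1) := by
  rcases lt_or_ge n 3 with h | h
  · interval_cases n <;> norm_num
  · exact (Nat.sub_le _ _).trans (succ_pow_le_pow_succ h)

instance finite_part {C : Type*} [Finite C] : Finite (Part C) := by
  classical
  exact Finite.of_equiv _ (Part.equivOption (α := C)).symm

section Counting

variable {I X : Type*} [Finite I] (θ : I → (X →. X))

instance finite_code : Finite (Code θ) := Subtype.finite

/-- The function that is nowhere defined is not a code, which makes the bound hold for `I` of size
at most `2` as well. -/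
theorem card_code_le : Nat.card (Code θ) ≤ Nat.card I ^ (Nat.card I + 1) := by
  classical
  refine le_trans ?_ (succ_pow_sub_one_le_pow_succ _)
  have hcard : Nat.card (I → Part I) = (Nat.card I + 1) ^ Nat.card I := by
    rw [Nat.card_fun, Nat.card_congr Part.equivOption, Finite.card_option]
  rw [← hcard]
  refine Nat.le_sub_one_of_lt (Finite.card_subtype_lt (x := fun _ => Part.none) ?_)
  rintro ⟨x, c, ⟨y, s, hy⟩, -, h⟩
  exact Part.notMem_none (c y) ((congrFun h s).symm ▸ Part.mem_map c hy)

end Counting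

end PartialMap

/-! ### Finite representations -/

open PartialMap in
theorem mainTheorem4 (τ : Set OpSym)
    (hτ : ({.comp, .dom, .ran} ⊆ τ ∧
            τ ⊆ {.comp, .dom, .antidom, .ran, .fix, .zero, .one}) ∨
          ({.comp, .antidom, .ran, .punion} ⊆ τ ∧
            τ ⊆ {.comp, .dom, .antidom, .ran, .fix, .punion, .iter, .zero, .one}))
    (S : Type u) [(sigLang τ).Structure S] [Finite S] (hS : Representable.{u, v} τ S) :
    ∃ Y : Type, Finite Y ∧ Nat.card Y ≤ Nat.card S ^ (Nat.card S + 1) ∧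
      RepresentableOver τ S Y := by
  obtain ⟨X, A, ⟨E⟩⟩ := hS
  -- The new base has to live in `Type`, so the family of functions is indexed by `Fin n`.
  obtain ⟨n, ⟨idx⟩⟩ := Finite.exists_equiv_fin S
  let θ : Fin n → (X →. X) := fun i => (E (idx.symm i) : X →. X)
  have hθ : Function.Injective θ :=
    Subtype.val_injective.comp (E.injective.comp idx.symm.injective)
  have hop : ∀ {k : ℕ} (o : (sigLang τ).Functions k) (v : Fin k → S),
      θ (idx (FirstOrder.Language.Structure.funMap o v)) =
        interp o.1 fun i => θ (idx (v (Fin.cast o.2.2 i))) := by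
    intro k o v
    have h := congrArg Subtype.val (E.map_fun o v)
    simp only [θ, Equiv.symm_apply_apply]
    exact h
  have hcomp : OpSym.comp ∈ τ := hτ.elim (fun h => h.1 (by simp)) fun h => h.1 (by simp)
  have hranτ : OpSym.ran ∈ τ := hτ.elim (fun h => h.1 (by simp)) fun h => h.1 (by simp)
  have hmul : ∀ s t, ∃ w, θ w = comp (θ s) (θ t) := fun s t =>
    ⟨_, (hop ⟨.comp, hcomp, rfl⟩ ![idx.symm s, idx.symm t]).trans (by simp [interp, OpSym.arity])⟩
  have hun : ∀ o : OpSym, o ∈ τ → ∀ (ho : o.arity = 1) (s : Fin n),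
      ∃ w, θ w = interp o fun _ => θ s := fun o ho h1 s =>
    ⟨_, (hop ⟨o, ho, h1⟩ fun _ => idx.symm s).trans (by simp)⟩
  have hran : ∀ s, ∃ e, θ e = ran (θ s) := hun .ran hranτ rfl
  have hdom : ∀ s, ∃ e, θ e = dom (θ s) := by
    rcases hτ with h | h
    · exact hun .dom (h.1 (by simp)) rfl
    · -- The domain operation is twofold antidomain.
      have hanti := hun .antidom (h.1 (by simp)) rfl
      intro s
      obtain ⟨e, he⟩ := hanti s
      obtain ⟨e', he'⟩ := hanti e
      refine ⟨e', he'.trans (funext fun x => Part.ext fun y => ?_)⟩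
      change y ∈ antidom (θ e) x ↔ _
      rw [mem_antidom, mem_dom, he]
      change (y = x ∧ ∀ z, z ∉ antidom (θ s) x) ↔ _
      simp [mem_antidom]
  choose mul hmul using hmul
  let θ' : (sigLang τ).Embedding S (Code θ →. Code θ) :=
    { toFun := fun s => act hmul hran (idx s)
      inj' := (act_injective hmul hran hdom hθ).comp idx.injective
      map_fun' := fun o v => act_eq_interp hmul hran hdom (hop o v)
      map_rel' := fun r => r.elim }
  have hn : Nat.card S = Nat.card (Fin n) := Nat.card_congr idx
  exact ⟨Code θ, inferInstance, hn ▸ card_code_le θ, θ'.toHom.range, ⟨θ'.equivRange⟩⟩
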